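/- **Conventions.** Let $\mathcal A$ be a weakly idempotent complete exact category: an additive category in which every split monomorphism has a cokernel, equipped with a Quillen exact structure. Let $\mathcal P$ and $\mathcal I$ be the classes of projective and of injective objects of the exact category $\mathcal A$. A model structure $(\mathrm{CoFib},\mathrm{Fib},\mathrm{Weq})$ on $\mathcal A$ is a triple of classes of morphisms satisfying the two-out-of-three, retract, lifting and factorization axioms (no existence of limits or colimits is required); put $\mathrm{TCoFib}=\mathrm{CoFib}\cap\mathrm{Weq}$ and $\mathrm{TFib}=\mathrm{Fib}\cap\mathrm{Weq}$. An object $X$ is cofibrant if $0\to X$ lies in $\mathrm{CoFib}$, and fibrant if $X\to 0$ lies in $\mathrm{Fib}$. For a class $\mathcal U$ of objects, a morphism $f$ is $\mathrm{Hom}(\mathcal U,-)$-epic (resp. $\mathrm{Hom}(-,\mathcal U)$-epic) if $\mathrm{Hom}(U,f)$ (resp. $\mathrm{Hom}(f,U)$) is surjective for all $U\in\mathcal U$; $\mathcal U$ is contravariantly finite if every object $B$ admits a morphism $t:U\to B$ with $U\in\mathcal U$ through which every morphism $U'\to B$ with $U'\in\mathcal U$ factors. For classes $R,L$ of morphisms,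 $R\circ L$ is the class of composites $p\circ i$ with $i\in L$, $p\in R$. * A model structure is *exact* if the cofibrations are precisely the inflations with cofibrant cokernel and the fibrations are precisely the deflations with fibrant kernel. An exact model structure is *projective* (resp. *injective*) if every object is fibrant (resp. cofibrant), and *Frobenius* if it is both. * Let $\mathcal X,\mathcal Y$ be full additive subcategories closed under direct summands and isomorphisms, and $\omega=\mathcal X\cap\mathcal Y$. A model structure is the *$\omega$-model structure* given by $(\mathcal X,\mathcal Y)$ if $\mathrm{CoFib}=\{\text{inflations } f: \mathrm{Coker} f\in\mathcal X\}$, $\mathrm{Fib}=\{f: f \text{ is } \mathrm{Hom}(\omega,-)\text{-epic}\}$, $\mathrm{TCoFib}=\mathrm{TCoFib}_\omega:=\{\text{split monomorphisms } f: \mathrm{Coker} f\in\omega\}$, $\mathrm{TFib}=\mathrm{TFib}_\omega:=\{\text{deflations } f: \mathrm{Ker} f\in\mathcal Y\}$ and $\mathrm{Weq}=\mathrm{TFib}_\omega\circ\mathrm{TCoFib}_\omega$. * Let $\mathcal W$ be a full subcategory closed under isomorphisms. A model structure is the *$\mathcal W$-model structure* given by $\mathcal W$ if $\mathrm{CoFib}=\{f: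 f\text{ is }\mathrm{Hom}(-,\mathcal W)\text{-epic}\}$, $\mathrm{Fib}=\{f: f\text{ is }\mathrm{Hom}(\mathcal W,-)\text{-epic}\}$, $\mathrm{TCoFib}=\{\text{split monomorphisms } f: \mathrm{Coker} f\in\mathcal W\}$, $\mathrm{TFib}=\{\text{split epimorphisms } f: \mathrm{Ker} f\in\mathcal W\}$ and $\mathrm{Weq}=\mathrm{TFib}\circ\mathrm{TCoFib}$. **Proposition.** (1) For an $\omega$-model structure on $\mathcal A$ given by $(\mathcal X,\mathcal Y)$ the following are equivalent: it is exact; $\mathcal A$ has enough projective objects and $\omega=\mathcal P$; it is projective. If this is the case, then $\mathrm{CoFib}=\{\text{inflations } f: \mathrm{Coker} f\in\mathcal X\}$, $\mathrm{Fib}=\{\text{deflations}\}$, $\mathrm{TCoFib}=\{\text{split monomorphisms } f: \mathrm{Coker} f\in\mathcal P\}$, $\mathrm{TFib}=\{\text{deflations } f: \mathrm{Ker} f\in\mathcal Y\}$ and $\mathrm{Weq}=\mathrm{TFib}\circ\mathrm{TCoFib}$. (2) A $\mathcal W$-model structure on $\mathcal A$ is an $\omega$-model structure (for some $\mathcal X,\mathcal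 Y$) if and only if $\mathcal A$ has enough injective objects and $\mathcal W=\mathcal I$. If this is the case, then $\omega=\mathcal W=\mathcal I$ (for every pair $(\mathcal X,\mathcal Y)$ presenting it as an $\omega$-model structure), this class is contravariantly finite in $\mathcal A$, and $\mathrm{CoFib}=\{\text{inflations}\}$, $\mathrm{Fib}=\{f: f\text{ is }\mathrm{Hom}(\mathcal I,-)\text{-epic}\}$, $\mathrm{TCoFib}=\{\text{split monomorphisms } f: \mathrm{Coker} f\in\mathcal I\}$, $\mathrm{TFib}=\{\text{split epimorphisms } f: \mathrm{Ker} f\in\mathcal I\}$ and $\mathrm{Weq}=\mathrm{TFib}\circ\mathrm{TCoFib}=\mathrm{TFib}_\omega\circ\mathrm{TCoFib}_\omega$. (3) For a model structure $(\mathrm{CoFib},\mathrm{Fib},\mathrm{Weq})$ on $\mathcal A$ the following are equivalent: (i) it is both an exact model structure and a $\mathcal W$-model structure for some $\mathcal W$; (ii) it is a Frobenius model structure; (iii) it is simultaneously an exact model structure, an $\omega$-model structure for some $\mathcal X,\mathcal Y$, and a $\mathcal W$-model structure for some $\mathcal W$. If this is the case, then $\omega=\mathcal W=\mathcal P=\mathcal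 I$ (for all $\mathcal X,\mathcal Y$ and $\mathcal W$ presenting it), $\mathrm{CoFib}=\{\text{inflations}\}$, $\mathrm{Fib}=\{\text{deflations}\}$, and $\mathrm{Weq}$ is the class of morphisms $f$ whose image in the additive quotient category $\mathcal A/\mathcal P$ is an isomorphism. -/

import Mathlib

open CategoryTheory CategoryTheory.Limits

universe v u

namespace ExactModel

open scoped ZeroObject

section General

variable {C : Type u} [Category.{v} C]

/-- The class of composites `p ∘ i` with `i ∈ L` and `p ∈ R`. -/
def compClass (L R : MorphismProperty C) : MorphismProperty C :=
  fun A B f => ∃ (Z : C) (i : A ⟶ Z) (p : Z ⟶ B), L i ∧ R p ∧ i ≫ p = f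

/-- `f` is `Hom(U, -)`-epic: `Hom(W, f)` is surjective for every `W ∈ U`. -/
def homFromEpic (U : ObjectProperty C) : MorphismProperty C :=
  fun A B f => ∀ W : C, U W → Function.Surjective (fun h : W ⟶ A => (h ≫ f : W ⟶ B))

/-- `f` is `Hom(-, U)`-epic: `Hom(f, W)` is surjective for every `W ∈ U`. -/
def homToEpic (U : ObjectProperty C) : MorphismProperty C :=
  fun A B f => ∀ W : C, U W → Function.Surjective (fun h : B ⟶ W => (f ≫ h : A ⟶ W))

/-- `U` is contravariantly finite: every object has a right `U`-approximation. -/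
def ContravariantlyFinite (U : ObjectProperty C) : Prop :=
  ∀ B : C, ∃ (W : C) (t : W ⟶ B), U W ∧ ∀ (W' : C) (s : W' ⟶ B), U W' → ∃ h : W' ⟶ W, h ≫ t = s

/-- A (Quillen closed) model structure on a category; no existence of limits or colimits is
required. -/
structure ModelStructure (C : Type u) [Category.{v} C] where
  /-- the cofibrations -/
  cof : MorphismProperty C
  /-- the fibrations -/
  fib : MorphismProperty C
  /-- the weak equivalences -/
  weq : MorphismProperty C
  two_out_of_three : weq.HasTwoOutOfThreeProperty
  cof_retract : cof.IsStableUnderRetracts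
  fib_retract : fib.IsStableUnderRetracts
  weq_retract : weq.IsStableUnderRetracts
  lift_trivCof : ∀ {A B X Y : C} (i : A ⟶ B) (p : X ⟶ Y),
    cof i → weq i → fib p → HasLiftingProperty i p
  lift_trivFib : ∀ {A B X Y : C} (i : A ⟶ B) (p : X ⟶ Y),
    cof i → fib p → weq p → HasLiftingProperty i p
  fac_trivCof_fib : ∀ {X Y : C} (f : X ⟶ Y), compClass (cof ⊓ weq) fib f
  fac_cof_trivFib : ∀ {X Y : C} (f : X ⟶ Y), compClass cof (fib ⊓ weq) f

namespace ModelStructure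

variable (M : ModelStructure C)

/-- Trivial cofibrations. -/
def trivCof : MorphismProperty C := M.cof ⊓ M.weq

/-- Trivial fibrations. -/
def trivFib : MorphismProperty C := M.fib ⊓ M.weq

variable [HasZeroMorphisms C] [HasZeroObject C]

/-- Cofibrant objects. -/
def cofibrant : ObjectProperty C := fun X => M.cof (0 : (0 : C) ⟶ X)

/-- Fibrant objects. -/
def fibrant : ObjectProperty C := fun X => M.fib (0 : X ⟶ (0 : C))

end ModelStructure

end General

section Additive

variable {C : Type u} [Category.{v} C] [Preadditive C]

variable (C) in
/-- Weak idempotent completeness: every split monomorphism has a cokernel. -/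
def WeaklyIdempotentComplete : Prop :=
  ∀ ⦃X Y : C⦄ (f : X ⟶ Y), IsSplitMono f → HasCokernel f

/-- Split monomorphisms whose cokernel lies in `U`. -/
def splitMonoCoker (U : ObjectProperty C) : MorphismProperty C :=
  fun _ B f => IsSplitMono f ∧ ∃ (Z : C) (g : B ⟶ Z) (w : f ≫ g = 0),
    Nonempty (IsColimit (CokernelCofork.ofπ g w)) ∧ U Z

/-- Split epimorphisms whose kernel lies in `U`. -/
def splitEpiKer (U : ObjectProperty C) : MorphismProperty C :=
  fun A _ f => IsSplitEpi f ∧ ∃ (K : C) (k : K ⟶ A) (w : k ≫ f = 0),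
    Nonempty (IsLimit (KernelFork.ofι k w)) ∧ U K

/-- A full additive subcategory closed under isomorphisms and direct summands. -/
structure IsAdditiveSummandClosed [HasZeroObject C] [HasBinaryBiproducts C]
    (U : ObjectProperty C) : Prop where
  zero : U (0 : C)
  biprod : ∀ X Y : C, U X → U Y → U (X ⊞ Y)
  iso : ∀ {X Y : C}, (X ≅ Y) → U X → U Y
  summand : ∀ X Y : C, U (X ⊞ Y) → U X

/-- Two parallel morphisms are related when their difference factors through an object of `U`. -/
def factorRel (U : ObjectProperty C) : HomRel C :=
  fun X Y f g => ∃ (W : C) (a : X ⟶ W) (b : W ⟶ Y), U W ∧ a ≫ b = f - g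

/-- The quotient category `C/U` for a full additive subcategory `U`. -/
abbrev AdditiveQuotient (U : ObjectProperty C) := CategoryTheory.Quotient (factorRel U)

/-- The morphisms of `C` that become isomorphisms in `C/U`. -/
def isoInQuotient (U : ObjectProperty C) : MorphismProperty C :=
  (MorphismProperty.isomorphisms (AdditiveQuotient U)).inverseImage
    (CategoryTheory.Quotient.functor (factorRel U))

/-- The first morphisms of the short complexes in `S`. -/
def firstMaps (S : ObjectProperty (ShortComplex C)) : MorphismProperty C :=
  fun _ B f => ∃ (Z : C) (g : B ⟶ Z) (w : f ≫ g = 0), S (ShortComplex.mk f g w)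

/-- The second morphisms of the short complexes in `S`. -/
def secondMaps (S : ObjectProperty (ShortComplex C)) : MorphismProperty C :=
  fun A _ f => ∃ (K : C) (k : K ⟶ A) (w : k ≫ f = 0), S (ShortComplex.mk k f w)

variable (C) in
/-- A Quillen exact structure on an additive category: a class of kernel-cokernel pairs, closed
under isomorphism, such that inflations (resp. deflations) contain the identities, are closed under
composition and under push-outs (resp. pull-backs), which are required to exist. -/
structure ExactStructure where
  /-- the conflations, i.e. the admissible exact sequences -/
  conflation : ObjectProperty (ShortComplex C)
  iso_closed : ∀ {S T : ShortComplex C}, (S ≅ T) → conflation S → conflation T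
  isKernel : ∀ S : ShortComplex C, conflation S → Nonempty (IsLimit (KernelFork.ofι S.f S.zero))
  isCokernel : ∀ S : ShortComplex C, conflation S →
    Nonempty (IsColimit (CokernelCofork.ofπ S.g S.zero))
  inflation_id : ∀ X : C, firstMaps conflation (𝟙 X)
  deflation_id : ∀ X : C, secondMaps conflation (𝟙 X)
  inflation_comp : ∀ {X Y Z : C} (f : X ⟶ Y) (g : Y ⟶ Z),
    firstMaps conflation f → firstMaps conflation g → firstMaps conflation (f ≫ g)
  deflation_comp : ∀ {X Y Z : C} (f : X ⟶ Y) (g : Y ⟶ Z),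
    secondMaps conflation f → secondMaps conflation g → secondMaps conflation (f ≫ g)
  inflation_pushout : ∀ {A B A' : C} (f : A ⟶ B) (a : A ⟶ A'), firstMaps conflation f →
    ∃ (B' : C) (b : B ⟶ B') (f' : A' ⟶ B'), IsPushout f a b f' ∧ firstMaps conflation f'
  deflation_pullback : ∀ {A B B' : C} (f : A ⟶ B) (b : B' ⟶ B), secondMaps conflation f →
    ∃ (A' : C) (a : A' ⟶ A) (f' : A' ⟶ B'), IsPullback a f' f b ∧ secondMaps conflation f'

namespace ExactStructure

variable (E : ExactStructure C)

/-- Inflations (admissible monomorphisms). -/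
def inflation : MorphismProperty C := firstMaps E.conflation

/-- Deflations (admissible epimorphisms). -/
def deflation : MorphismProperty C := secondMaps E.conflation

/-- Inflations whose cokernel lies in `U`. -/
def inflationCoker (U : ObjectProperty C) : MorphismProperty C :=
  fun _ B f => ∃ (Z : C) (g : B ⟶ Z) (w : f ≫ g = 0), E.conflation (ShortComplex.mk f g w) ∧ U Z

/-- Deflations whose kernel lies in `U`. -/
def deflationKer (U : ObjectProperty C) : MorphismProperty C :=
  fun A _ f => ∃ (K : C) (k : K ⟶ A) (w : k ≫ f = 0), E.conflation (ShortComplex.mk k f w) ∧ U K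

/-- Projective objects of the exact category. -/
def proj : ObjectProperty C :=
  fun P => ∀ ⦃A B : C⦄ (f : A ⟶ B), E.deflation f →
    Function.Surjective (fun h : P ⟶ A => (h ≫ f : P ⟶ B))

/-- Injective objects of the exact category. -/
def inj : ObjectProperty C :=
  fun I => ∀ ⦃A B : C⦄ (f : A ⟶ B), E.inflation f →
    Function.Surjective (fun h : B ⟶ I => (f ≫ h : A ⟶ I))

/-- Every object is the target of a deflation from a projective object. -/
def EnoughProj : Prop := ∀ X : C, ∃ (P : C) (p : P ⟶ X), E.proj P ∧ E.deflation p

/-- Every object is the source of an inflation into an injective object. -/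
def EnoughInj : Prop := ∀ X : C, ∃ (I : C) (i : X ⟶ I), E.inj I ∧ E.inflation i

/-- Exact model structures: the cofibrations are precisely the inflations with cofibrant cokernel
and the fibrations are precisely the deflations with fibrant kernel. -/
structure IsExactModel [HasZeroObject C] (M : ModelStructure C) : Prop where
  cof_eq : M.cof = E.inflationCoker M.cofibrant
  fib_eq : M.fib = E.deflationKer M.fibrant

/-- Projective model structures: exact, and every object is fibrant. -/
structure IsProjectiveModel [HasZeroObject C] (M : ModelStructure C) : Prop where
  exact : E.IsExactModel M
  fibrant : ∀ X : C, M.fibrant X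

/-- Injective model structures: exact, and every object is cofibrant. -/
structure IsInjectiveModel [HasZeroObject C] (M : ModelStructure C) : Prop where
  exact : E.IsExactModel M
  cofibrant : ∀ X : C, M.cofibrant X

/-- Frobenius model structures: both projective and injective. -/
structure IsFrobeniusModel [HasZeroObject C] (M : ModelStructure C) : Prop where
  projective : E.IsProjectiveModel M
  injective : E.IsInjectiveModel M

/-- `M` is the `ω`-model structure given by the full additive subcategories `𝒳` and `𝒴`,
where `ω = 𝒳 ∩ 𝒴`. -/
structure IsOmegaModelOf [HasZeroObject C] [HasBinaryBiproducts C]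
    (M : ModelStructure C) (𝒳 𝒴 : ObjectProperty C) : Prop where
  left : IsAdditiveSummandClosed 𝒳
  right : IsAdditiveSummandClosed 𝒴
  cof_eq : M.cof = E.inflationCoker 𝒳
  fib_eq : M.fib = homFromEpic (𝒳 ⊓ 𝒴)
  trivCof_eq : M.trivCof = splitMonoCoker (𝒳 ⊓ 𝒴)
  trivFib_eq : M.trivFib = E.deflationKer 𝒴
  weq_eq : M.weq = compClass (splitMonoCoker (𝒳 ⊓ 𝒴)) (E.deflationKer 𝒴)

/-- `M` is an `ω`-model structure. -/
def IsOmegaModel [HasZeroObject C] [HasBinaryBiproducts C] (M : ModelStructure C) : Prop :=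
  ∃ 𝒳 𝒴 : ObjectProperty C, E.IsOmegaModelOf M 𝒳 𝒴

end ExactStructure

/-- `M` is the `𝒲`-model structure given by the isomorphism-closed full subcategory `𝒲`. -/
structure IsWModelOf (M : ModelStructure C) (𝒲 : ObjectProperty C) : Prop where
  iso : ∀ {X Y : C}, (X ≅ Y) → 𝒲 X → 𝒲 Y
  cof_eq : M.cof = homToEpic 𝒲
  fib_eq : M.fib = homFromEpic 𝒲
  trivCof_eq : M.trivCof = splitMonoCoker 𝒲
  trivFib_eq : M.trivFib = splitEpiKer 𝒲
  weq_eq : M.weq = compClass (splitMonoCoker 𝒲) (splitEpiKer 𝒲)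

/-- `M` is a `𝒲`-model structure for some `𝒲`. -/
def IsWModel (M : ModelStructure C) : Prop :=
  ∃ 𝒲 : ObjectProperty C, IsWModelOf M 𝒲

end Additive

end ExactModel

/-! Two facts drive all three parts. First, in a weakly idempotent complete exact category `f` is a
deflation as soon as some `h ≫ f` is (`deflation_of_precomp`), and dually for inflations. So with
enough projectives the `Hom(proj, -)`-epic maps are exactly the deflations, and with enough
injectives the `Hom(-, inj)`-epic maps are exactly the inflations. Second, factoring `0 ⟶ B` or `X ⟶
0` in the model structure produces covers and embeddings by objects of the distinguished class.

In an `ω`-model structure every map to `0` is a fibration, so exactness amounts to projectivity and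
forces the fibrations to be the deflations. Objects of `ω` are then projective, the factorization of
`0 ⟶ B` covers `B` by one of them, and a projective `B` splits off its cover. The converse is the
first fact. In a `𝒲`-model structure every object is cofibrant, so an `ω`-presentation makes the
cofibrations the inflations, and the dual argument gives `𝒲 = inj`; conversely the pair `(⊤, inj)`
presents it.

An exact `𝒲`-model structure is Frobenius because all objects are bifibrant. In a Frobenius one,
lifting identifies trivial cofibrations with split monos having projective cokernel and trivial
fibrations with split epis having injective kernel; two-out-of-three on `0 ⟶ X ⟶ 0` then gives `proj
= inj`. Both kinds of maps are invertible modulo projectives. Conversely, a deflation invertible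
modulo projectives is a split epi with projective kernel, so the fibration part of a stably
invertible map is trivial. -/

namespace ExactModel

open scoped ZeroObject

/-! ### Split short complexes and weak idempotent completeness -/

section Splittings

variable {C : Type u} [Category.{v} C] [Preadditive C]

/-- A split monomorphism together with a cokernel gives a split short complex. -/
noncomputable def splittingOfRetraction {A B Z : C} {f : A ⟶ B} {g : B ⟶ Z} (w : f ≫ g = 0)
    (h : IsColimit (CokernelCofork.ofπ g w)) (r : B ⟶ A) (hr : f ≫ r = 𝟙 A) :
    (ShortComplex.mk f g w).Splitting :=
  have hd : f ≫ (𝟙 B - r ≫ f) = 0 := by simp [reassoc_of% hr]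
  have hs : g ≫ (CokernelCofork.IsColimit.desc' h _ hd).1 = 𝟙 B - r ≫ f :=
    (CokernelCofork.IsColimit.desc' h _ hd).2
  { r := r
    s := (CokernelCofork.IsColimit.desc' h _ hd).1
    f_r := hr
    s_g := by
      refine Cofork.IsColimit.hom_ext h ?_
      change g ≫ _ ≫ g = g ≫ 𝟙 Z
      rw [reassoc_of% hs]
      simp [w]
    id := by
      dsimp only
      rw [hs]
      abel }

/-- A split epimorphism together with a kernel gives a split short complex. -/
noncomputable def splittingOfSection {K A B : C} {k : K ⟶ A} {f : A ⟶ B} (w : k ≫ f = 0)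
    (h : IsLimit (KernelFork.ofι k w)) (s : B ⟶ A) (hs : s ≫ f = 𝟙 B) :
    (ShortComplex.mk k f w).Splitting :=
  have hd : (𝟙 A - f ≫ s) ≫ f = 0 := by simp [hs]
  have hr : (KernelFork.IsLimit.lift' h _ hd).1 ≫ k = 𝟙 A - f ≫ s :=
    (KernelFork.IsLimit.lift' h _ hd).2
  { r := (KernelFork.IsLimit.lift' h _ hd).1
    s := s
    f_r := by
      refine Fork.IsLimit.hom_ext h ?_
      change (k ≫ _) ≫ k = 𝟙 K ≫ k
      rw [Category.assoc, hr]
      simp [reassoc_of% w]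
    s_g := hs
    id := by
      dsimp only
      rw [hr]
      abel }

/-- Exchanging the two summands of a split short complex. -/
def swapSplitting {S : ShortComplex C} (s : S.Splitting) :
    (ShortComplex.mk s.s s.r s.s_r).Splitting where
  r := S.g
  s := S.f
  f_r := s.s_g
  s_g := s.f_r
  id := by rw [add_comm]; exact s.id

theorem exists_splitting_of_retraction (hC : WeaklyIdempotentComplete C) {A B : C} (f : A ⟶ B)
    (r : B ⟶ A) (hr : f ≫ r = 𝟙 A) :
    ∃ (Z : C) (g : B ⟶ Z) (w : f ≫ g = 0), ∃ s : (ShortComplex.mk f g w).Splitting, s.r = r := by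
  have := hC f ⟨⟨⟨r, hr⟩⟩⟩
  exact ⟨_, _, _, splittingOfRetraction (cokernel.condition f) (cokernelIsCokernel f) r hr, rfl⟩

theorem exists_splitting_of_section (hC : WeaklyIdempotentComplete C) {A B : C} (f : A ⟶ B)
    (s : B ⟶ A) (hs : s ≫ f = 𝟙 B) :
    ∃ (K : C) (k : K ⟶ A) (w : k ≫ f = 0), Nonempty (ShortComplex.mk k f w).Splitting := by
  obtain ⟨Z, g, w, t, rfl⟩ := exists_splitting_of_retraction hC s f hs
  exact ⟨_, _, _, ⟨swapSplitting t⟩⟩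

/-- The condition is self-dual: the complement of a section, read backwards, is a kernel of the
split epimorphism. -/
theorem WeaklyIdempotentComplete.op [HasZeroObject C] (hC : WeaklyIdempotentComplete C) :
    WeaklyIdempotentComplete Cᵒᵖ := by
  rintro X Y f ⟨⟨r, hr⟩⟩
  obtain ⟨K, k, w, ⟨s⟩⟩ := exists_splitting_of_section hC f.unop r.unop
    (by rw [← unop_comp, hr, unop_id])
  exact ⟨⟨⟨_, s.op.gIsCokernel⟩⟩⟩

end Splittings

namespace ExactStructure

/-! ### Basic properties of exact structures and duality -/

section Basic

variable {C : Type u} [Category.{v} C] [Preadditive C] (E : ExactStructure C)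

theorem conflation_of_deflation {K A B : C} {k : K ⟶ A} {f : A ⟶ B} (w : k ≫ f = 0)
    (hk : IsLimit (KernelFork.ofι k w)) (hf : E.deflation f) :
    E.conflation (ShortComplex.mk k f w) := by
  obtain ⟨K', k', w', h⟩ := hf
  obtain ⟨h'⟩ := E.isKernel _ h
  refine E.iso_closed (S := ShortComplex.mk k' f w') (ShortComplex.isoMk
    (h'.conePointUniqueUpToIso hk) (Iso.refl _) (Iso.refl _) ?_ (by simp)) h
  simpa using h'.conePointUniqueUpToIso_hom_comp hk WalkingParallelPair.zero

theorem conflation_of_inflation {A B Z : C} {f : A ⟶ B} {g : B ⟶ Z} (w : f ≫ g = 0)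
    (hg : IsColimit (CokernelCofork.ofπ g w)) (hf : E.inflation f) :
    E.conflation (ShortComplex.mk f g w) := by
  obtain ⟨Z', g', w', h⟩ := hf
  obtain ⟨h'⟩ := E.isCokernel _ h
  refine E.iso_closed (S := ShortComplex.mk f g' w') (ShortComplex.isoMk (Iso.refl _) (Iso.refl _)
    (h'.coconePointUniqueUpToIso hg) (by simp) ?_) h
  simpa using (h'.comp_coconePointUniqueUpToIso_hom hg WalkingParallelPair.one).symm

theorem inflation_of_conflation {S : ShortComplex C} (h : E.conflation S) : E.inflation S.f :=
  ⟨_, _, S.zero, h⟩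

theorem deflation_of_conflation {S : ShortComplex C} (h : E.conflation S) : E.deflation S.g :=
  ⟨_, _, S.zero, h⟩

theorem deflation_of_iso {A B A' B' : C} {f : A ⟶ B} {f' : A' ⟶ B'} (e : A ≅ A') (e' : B ≅ B')
    (comm : e.hom ≫ f' = f ≫ e'.hom) (hf : E.deflation f) : E.deflation f' := by
  obtain ⟨K, k, w, h⟩ := hf
  exact ⟨K, k ≫ e.hom, by simp [comm, reassoc_of% w],
    E.iso_closed (S := ShortComplex.mk k f w)
      (ShortComplex.isoMk (Iso.refl _) e e' (by simp) (by simpa using comm)) h⟩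

theorem inflation_of_iso {A B A' B' : C} {f : A ⟶ B} {f' : A' ⟶ B'} (e : A ≅ A') (e' : B ≅ B')
    (comm : e.hom ≫ f' = f ≫ e'.hom) (hf : E.inflation f) : E.inflation f' := by
  obtain ⟨Z, g, w, h⟩ := hf
  have comm' : f' ≫ e'.inv = e.inv ≫ f := by rw [Iso.comp_inv_eq, Category.assoc, ← comm]; simp
  exact ⟨Z, e'.inv ≫ g, by simp [reassoc_of% comm', w],
    E.iso_closed (S := ShortComplex.mk f g w)
      (ShortComplex.isoMk e e' (Iso.refl _) (by simpa using comm) (by simp)) h⟩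

theorem deflation_of_isPullback {A B A' B' : C} {f : A ⟶ B} {b : B' ⟶ B} {a : A' ⟶ A}
    {f' : A' ⟶ B'} (h : IsPullback a f' f b) (hf : E.deflation f) : E.deflation f' := by
  obtain ⟨A'', a'', f'', h'', hd⟩ := E.deflation_pullback f b hf
  exact E.deflation_of_iso (h''.isoIsPullback _ _ h) (Iso.refl _) (by simp) hd

theorem inflation_of_isPushout {A B A' B' : C} {f : A ⟶ B} {a : A ⟶ A'} {b : B ⟶ B'}
    {f' : A' ⟶ B'} (h : IsPushout f a b f') (hf : E.inflation f) : E.inflation f' := by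
  obtain ⟨B'', b'', f'', h'', hd⟩ := E.inflation_pushout f a hf
  exact E.inflation_of_iso (Iso.refl _) (h''.isoIsPushout _ _ h) (by simp) hd

/-- The cokernel of the inflation `𝟙 A` is a zero object. -/
theorem deflation_to_zero [HasZeroObject C] (A : C) : E.deflation (0 : A ⟶ (0 : C)) := by
  obtain ⟨Z, g, w, h⟩ := E.inflation_id A
  have hg : g = 0 := by simpa using w
  subst hg
  obtain ⟨hc⟩ := E.isCokernel _ h
  have hZ : IsZero Z := by
    rw [IsZero.iff_id_eq_zero]
    exact Cofork.IsColimit.hom_ext hc (by simp)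
  exact E.deflation_of_iso (Iso.refl _) (hZ.isoZero) (by simp) (E.deflation_of_conflation h)

/-- The projection off a direct summand is the pullback of the deflation `S.X₁ ⟶ 0` along `S.X₃ ⟶
0`. -/
theorem conflation_of_splitting [HasZeroObject C] {S : ShortComplex C} (s : S.Splitting) :
    E.conflation S := by
  have h : IsPullback s.r S.g (0 : S.X₁ ⟶ (0 : C)) (0 : S.X₃ ⟶ (0 : C)) := by
    refine ⟨⟨by simp⟩, ⟨PullbackCone.IsLimit.mk _ (fun t => t.fst ≫ S.f + t.snd ≫ s.s)
      (fun t => by simp [s.s_r]) (fun t => by simp) ?_⟩⟩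
    intro t m h₁ h₂
    rw [← h₁, ← h₂, Category.assoc, Category.assoc, ← Preadditive.comp_add, s.id, Category.comp_id]
  exact E.conflation_of_deflation S.zero s.fIsKernel
    (E.deflation_of_isPullback h (E.deflation_to_zero _))

/-- The opposite exact structure. -/
def op : ExactStructure Cᵒᵖ where
  conflation S := E.conflation S.unop
  iso_closed {S T} e h := E.iso_closed (S := S.unop) (ShortComplex.isoMk
    ((ShortComplex.π₃.mapIso e).unop.symm) ((ShortComplex.π₂.mapIso e).unop.symm)
    ((ShortComplex.π₁.mapIso e).unop.symm)
    (Quiver.Hom.op_inj e.inv.comm₂₃.symm) (Quiver.Hom.op_inj e.inv.comm₁₂.symm)) h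
  isKernel S h := (E.isCokernel _ h).map fun t => CokernelCofork.IsColimit.ofπOp _ _ t
  isCokernel S h := (E.isKernel _ h).map fun t => KernelFork.IsLimit.ofιOp _ _ t
  inflation_id X := by
    obtain ⟨K, k, w, h⟩ := E.deflation_id X.unop
    exact ⟨_, k.op, congrArg Quiver.Hom.op w, h⟩
  deflation_id X := by
    obtain ⟨K, k, w, h⟩ := E.inflation_id X.unop
    exact ⟨_, k.op, congrArg Quiver.Hom.op w, h⟩
  inflation_comp f g := by
    rintro ⟨K, k, w, h⟩ ⟨K', k', w', h'⟩
    obtain ⟨K'', k'', w'', h''⟩ := E.deflation_comp g.unop f.unop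
      ⟨_, k'.unop, congrArg Quiver.Hom.unop w', h'⟩ ⟨_, k.unop, congrArg Quiver.Hom.unop w, h⟩
    exact ⟨_, k''.op, congrArg Quiver.Hom.op w'', h''⟩
  deflation_comp f g := by
    rintro ⟨K, k, w, h⟩ ⟨K', k', w', h'⟩
    obtain ⟨K'', k'', w'', h''⟩ := E.inflation_comp g.unop f.unop
      ⟨_, k'.unop, congrArg Quiver.Hom.unop w', h'⟩ ⟨_, k.unop, congrArg Quiver.Hom.unop w, h⟩
    exact ⟨_, k''.op, congrArg Quiver.Hom.op w'', h''⟩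
  inflation_pushout f a := by
    rintro ⟨K, k, w, h⟩
    obtain ⟨A', a', f', hp, K', k', w', h'⟩ := E.deflation_pullback f.unop a.unop
      ⟨_, k.unop, congrArg Quiver.Hom.unop w, h⟩
    exact ⟨_, a'.op, f'.op, hp.op.flip, _, k'.op, congrArg Quiver.Hom.op w', h'⟩
  deflation_pullback f a := by
    rintro ⟨K, k, w, h⟩
    obtain ⟨A', a', f', hp, K', k', w', h'⟩ := E.inflation_pushout f.unop a.unop
      ⟨_, k.unop, congrArg Quiver.Hom.unop w, h⟩
    exact ⟨_, a'.op, f'.op, hp.op.flip, _, k'.op, congrArg Quiver.Hom.op w', h'⟩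

theorem deflation_op {A B : C} {f : A ⟶ B} (hf : E.inflation f) : E.op.deflation f.op := by
  obtain ⟨K, k, w, h⟩ := hf
  exact ⟨_, k.op, congrArg Quiver.Hom.op w, h⟩

theorem inflation_of_deflation_op {A B : C} {f : A ⟶ B} (hf : E.op.deflation f.op) :
    E.inflation f := by
  obtain ⟨K, k, w, h⟩ := hf
  exact ⟨_, k.unop, congrArg Quiver.Hom.unop w, h⟩

end Basic

/-! ### Cancellation for deflations and inflations -/

section Cancellation

variable {C : Type u} [Category.{v} C] [Preadditive C] [HasZeroObject C] [HasBinaryBiproducts C]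
  (E : ExactStructure C)

/-- The map `(f, 0) : A ⊞ P ⟶ B` is a deflation, since a shear turns it into `(f, h ≫ f)`. It
remains to remove the summand `P`: weak idempotent completeness supplies a kernel of `f`, and a
pushout of the kernel of `(f, 0)` shows that this kernel is an inflation. -/
theorem deflation_of_precomp (hC : WeaklyIdempotentComplete C) {P A B : C} (h : P ⟶ A) (f : A ⟶ B)
    (hf : E.deflation (h ≫ f)) : E.deflation f := by
  have h₁ : E.deflation (biprod.map (𝟙 A) (h ≫ f)) := by
    refine E.deflation_of_isPullback (a := biprod.snd) (b := biprod.snd)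
      ⟨⟨by simp⟩, ⟨PullbackCone.IsLimit.mk _ (fun t => biprod.lift (t.snd ≫ biprod.fst) t.fst)
        (fun t => by simp) (fun t => ?_) ?_⟩⟩ hf
    · ext <;> simp [t.condition]
    · intro t m hm₁ hm₂
      ext <;> simp [← hm₁, ← hm₂]
  have h₂ : E.deflation (biprod.desc f (𝟙 B)) := by
    let t : (ShortComplex.mk (biprod.lift (𝟙 A) (-f)) (biprod.desc f (𝟙 B)) (by simp)).Splitting :=
      { r := biprod.fst
        s := biprod.inr
        f_r := by simp
        s_g := by simp
        id := by ext <;> simp }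
    exact E.deflation_of_conflation (E.conflation_of_splitting t)
  have h₃ : E.deflation (biprod.fst ≫ f : A ⊞ P ⟶ B) := by
    let e : A ⊞ P ≅ A ⊞ P :=
      { hom := biprod.lift (biprod.fst + biprod.snd ≫ h) biprod.snd
        inv := biprod.lift (biprod.fst - biprod.snd ≫ h) biprod.snd
        hom_inv_id := by ext <;> simp
        inv_hom_id := by ext <;> simp }
    refine E.deflation_of_iso e (Iso.refl B) ?_ (E.deflation_comp _ _ h₁ h₂)
    dsimp [e]
    ext <;> simp
  -- The pullback of `h ≫ f` and `f` projects to `P` with section `(𝟙, h)`, so that projection has a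
  -- kernel, and `k ≫ d` is then a kernel of `f`.
  obtain ⟨D, a, d, hp, -⟩ := E.deflation_pullback (h ≫ f) f hf
  obtain ⟨K, k, w, ⟨t⟩⟩ := exists_splitting_of_section hC a (hp.lift (𝟙 P) h (by simp)) (by simp)
  have hk := t.fIsKernel
  have w' : (k ≫ d) ≫ f = 0 := by rw [Category.assoc, ← hp.w, reassoc_of% w, zero_comp]
  have hmono : Mono (k ≫ d) := by
    refine ⟨fun x y hxy => Fork.IsLimit.hom_ext hk (hp.hom_ext ?_ ?_)⟩
    · change (x ≫ k) ≫ a = (y ≫ k) ≫ a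
      simp [w]
    · simpa using hxy
  have hlift : ∀ {X : C} (x : X ⟶ A), x ≫ f = 0 → ∃ l : X ⟶ K, l ≫ k ≫ d = x := by
    intro X x hx
    obtain ⟨l, hl⟩ := KernelFork.IsLimit.lift' hk (hp.lift 0 x (by simp [hx])) (by simp)
    have hl' : l ≫ k = hp.lift 0 x (by simp [hx]) := hl
    exact ⟨l, by rw [reassoc_of% hl', hp.lift_snd]⟩
  have w₂ : biprod.map (k ≫ d) (𝟙 P) ≫ biprod.fst ≫ f = 0 := by
    rw [biprod.map_fst_assoc, w', comp_zero]
  have hmono' : Mono (biprod.map (k ≫ d) (𝟙 P)) := by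
    refine ⟨fun x y hxy => ?_⟩
    ext
    · rw [← cancel_mono (k ≫ d)]
      simpa using hxy =≫ biprod.fst
    · simpa using hxy =≫ biprod.snd
  have h₄ := E.conflation_of_deflation w₂ (KernelFork.IsLimit.ofι' _ _ (fun {X} x hx => by
    have hl := hlift (x ≫ biprod.fst) (by simpa using hx)
    exact ⟨biprod.lift hl.choose (x ≫ biprod.snd), by
      ext
      · simpa using hl.choose_spec
      · simp⟩)) h₃
  -- The kernel of `(f, 0)` is `(k ≫ d) ⊕ 𝟙 P`; its pushout along `K ⊞ P ⟶ K` is `k ≫ d`.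
  have h₅ : E.inflation (k ≫ d) := by
    refine E.inflation_of_isPushout (a := biprod.fst) (b := biprod.fst)
      ⟨⟨by simp⟩, ⟨PushoutCocone.IsColimit.mk _ (fun t => biprod.inl ≫ t.inl)
        (fun t => ?_) (fun t => ?_) ?_⟩⟩ (E.inflation_of_conflation h₄)
    · have := biprod.inr ≫= t.condition
      ext
      · simp
      · simpa using this.symm
    · have := biprod.inl ≫= t.condition
      simpa using this
    · intro t m hm₁ hm₂
      simp [← hm₁]
  obtain ⟨hcok⟩ := E.isCokernel _ h₄
  have hepi : Epi f := by
    refine ⟨fun x y hxy => Cofork.IsColimit.hom_ext hcok ?_⟩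
    change (biprod.fst ≫ f) ≫ x = (biprod.fst ≫ f) ≫ y
    rw [Category.assoc, hxy, Category.assoc]
  refine ⟨_, _, _, E.conflation_of_inflation w' (CokernelCofork.IsColimit.ofπ' _ _
    (fun {X} x hx => ?_)) h₅⟩
  obtain ⟨l, hl⟩ := CokernelCofork.IsColimit.desc' hcok (biprod.fst ≫ x) (by
    have : k ≫ d ≫ x = 0 := by simpa using hx
    ext <;> simp [this])
  have hl' : (biprod.fst ≫ f) ≫ l = biprod.fst ≫ x := hl
  exact ⟨l, by simpa using biprod.inl ≫= hl'⟩

theorem inflation_of_postcomp (hC : WeaklyIdempotentComplete C) {A B I : C} (f : A ⟶ B) (h : B ⟶ I)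
    (hf : E.inflation (f ≫ h)) : E.inflation f :=
  E.inflation_of_deflation_op (E.op.deflation_of_precomp hC.op h.op f.op (E.deflation_op hf))

end Cancellation

end ExactStructure

/-! ### Retract arguments in a model structure -/

namespace ModelStructure

variable {C : Type u} [Category.{v} C] (M : ModelStructure C)

theorem trivCof_of_llp {A B : C} (i : A ⟶ B)
    (h : ∀ {X Y : C} (p : X ⟶ Y), M.fib p → HasLiftingProperty i p) : M.trivCof i := by
  obtain ⟨Z, j, p, ⟨hj, hj'⟩, hp, fac⟩ := M.fac_trivCof_fib i
  have := h p hp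
  have hr := RetractArrow.ofLeftLiftingProperty fac
  exact ⟨M.cof_retract.of_retract hr hj, M.weq_retract.of_retract hr hj'⟩

theorem trivFib_of_rlp {X Y : C} (p : X ⟶ Y)
    (h : ∀ {A B : C} (i : A ⟶ B), M.cof i → HasLiftingProperty i p) : M.trivFib p := by
  obtain ⟨Z, i, q, hi, ⟨hq, hq'⟩, fac⟩ := M.fac_cof_trivFib p
  have := h i hi
  have hr := RetractArrow.ofRightLiftingProperty fac
  exact ⟨M.fib_retract.of_retract hr hq, M.weq_retract.of_retract hr hq'⟩

theorem weq_id (X : C) : M.weq (𝟙 X) :=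
  (M.trivCof_of_llp (𝟙 X) fun _ _ => inferInstance).2

theorem weq_eq_compClass : M.weq = compClass M.trivCof M.trivFib := by
  have := M.two_out_of_three
  ext A B f
  constructor
  · intro hf
    obtain ⟨Z, i, p, hi, hp, rfl⟩ := M.fac_trivCof_fib f
    exact ⟨Z, i, p, hi, ⟨hp, M.weq.of_precomp _ _ hi.2 hf⟩, rfl⟩
  · rintro ⟨Z, i, p, hi, hp, rfl⟩
    exact M.weq.comp_mem _ _ hi.2 hp.2

variable [HasZeroMorphisms C] [HasZeroObject C]

/-- Two-out-of-three, since `0 ⟶ X ⟶ 0` is an identity. -/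
theorem weq_from_zero_iff (X : C) : M.weq (0 : (0 : C) ⟶ X) ↔ M.weq (0 : X ⟶ (0 : C)) := by
  have := M.two_out_of_three
  have h : (0 : (0 : C) ⟶ X) ≫ (0 : X ⟶ (0 : C)) = 𝟙 _ := Subsingleton.elim _ _
  have h' := M.weq_id (0 : C)
  rw [← h] at h'
  exact ⟨fun hX => M.weq.of_precomp _ _ hX h', fun hX => M.weq.of_postcomp _ _ hX h'⟩

end ModelStructure

/-! ### Split maps, additive subcategories and the additive quotient -/

section Additive

variable {C : Type u} [Category.{v} C] [Preadditive C]

theorem splitMonoCoker.exists_splitting {U : ObjectProperty C} {A B : C} {f : A ⟶ B}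
    (h : splitMonoCoker U f) : ∃ (Z : C) (g : B ⟶ Z) (w : f ≫ g = 0),
      Nonempty (ShortComplex.mk f g w).Splitting ∧ U Z := by
  obtain ⟨⟨⟨r, hr⟩⟩, Z, g, w, ⟨hg⟩, hZ⟩ := h
  exact ⟨Z, g, w, ⟨splittingOfRetraction w hg r hr⟩, hZ⟩

theorem splitEpiKer.exists_splitting {U : ObjectProperty C} {A B : C} {f : A ⟶ B}
    (h : splitEpiKer U f) : ∃ (K : C) (k : K ⟶ A) (w : k ≫ f = 0),
      Nonempty (ShortComplex.mk k f w).Splitting ∧ U K := by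
  obtain ⟨⟨⟨r, hr⟩⟩, Z, g, w, ⟨hg⟩, hZ⟩ := h
  exact ⟨Z, g, w, ⟨splittingOfSection w hg r hr⟩, hZ⟩

variable [HasZeroObject C]

theorem splitMonoCoker_of_splitting {U : ObjectProperty C} {S : ShortComplex C} (s : S.Splitting)
    (h : U S.X₃) : splitMonoCoker U S.f :=
  ⟨s.isSplitMono_f, _, _, S.zero, ⟨s.gIsCokernel⟩, h⟩

theorem splitEpiKer_of_splitting {U : ObjectProperty C} {S : ShortComplex C} (s : S.Splitting)
    (h : U S.X₁) : splitEpiKer U S.g :=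
  ⟨s.isSplitEpi_g, _, _, S.zero, ⟨s.fIsKernel⟩, h⟩

/-- The split short complex `0 ⟶ X ⟶ X`. -/
noncomputable def splittingZeroLeft (X : C) :
    (ShortComplex.mk (0 : (0 : C) ⟶ X) (𝟙 X) zero_comp).Splitting where
  r := 0
  s := 𝟙 X

/-- The split short complex `X ⟶ X ⟶ 0`. -/
noncomputable def splittingZeroRight (X : C) :
    (ShortComplex.mk (𝟙 X) (0 : X ⟶ (0 : C)) comp_zero).Splitting where
  r := 𝟙 X
  s := 0

theorem splitMonoCoker_from_zero_iff {U : ObjectProperty C}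
    (hU : ∀ {X Y : C}, (X ≅ Y) → U X → U Y) (X : C) :
    splitMonoCoker U (0 : (0 : C) ⟶ X) ↔ U X := by
  refine ⟨fun h => ?_, fun h => splitMonoCoker_of_splitting (splittingZeroLeft X) h⟩
  obtain ⟨-, Z, g, w, ⟨hg⟩, hZ⟩ := h
  exact hU (hg.coconePointUniqueUpToIso (splittingZeroLeft X).gIsCokernel) hZ

theorem splitEpiKer_to_zero_iff {U : ObjectProperty C}
    (hU : ∀ {X Y : C}, (X ≅ Y) → U X → U Y) (X : C) :
    splitEpiKer U (0 : X ⟶ (0 : C)) ↔ U X := by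
  refine ⟨fun h => ?_, fun h => splitEpiKer_of_splitting (splittingZeroRight X) h⟩
  obtain ⟨-, Z, g, w, ⟨hg⟩, hZ⟩ := h
  exact hU (hg.conePointUniqueUpToIso (splittingZeroRight X).fIsKernel) hZ

/-- The class of maps remembers the objects through `0 ⟶ X`. This gives the uniqueness of `ω` and
`𝒲`. -/
theorem splitMonoCoker_injective {U V : ObjectProperty C}
    (hU : ∀ {X Y : C}, (X ≅ Y) → U X → U Y) (hV : ∀ {X Y : C}, (X ≅ Y) → V X → V Y)
    (h : splitMonoCoker U = splitMonoCoker V) : U = V := by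
  ext X
  rw [← splitMonoCoker_from_zero_iff hU, h, splitMonoCoker_from_zero_iff hV]

theorem homToEpic_from_zero (U : ObjectProperty C) (X : C) :
    homToEpic U (0 : (0 : C) ⟶ X) :=
  fun _ _ _ => ⟨0, Subsingleton.elim _ _⟩

theorem homFromEpic_to_zero (U : ObjectProperty C) (X : C) :
    homFromEpic U (0 : X ⟶ (0 : C)) :=
  fun _ _ _ => ⟨0, Subsingleton.elim _ _⟩

variable [HasBinaryBiproducts C]

theorem IsAdditiveSummandClosed.of_retract (hC : WeaklyIdempotentComplete C)
    {U : ObjectProperty C} (hU : IsAdditiveSummandClosed U) {X Y : C} (i : X ⟶ Y) (r : Y ⟶ X)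
    (h : i ≫ r = 𝟙 X) (hY : U Y) : U X := by
  obtain ⟨Z, g, w, s, -⟩ := exists_splitting_of_retraction hC i r h
  exact hU.summand X Z (hU.iso s.isoBinaryBiproduct hY)

theorem IsAdditiveSummandClosed.inf {U V : ObjectProperty C} (hU : IsAdditiveSummandClosed U)
    (hV : IsAdditiveSummandClosed V) : IsAdditiveSummandClosed (U ⊓ V) where
  zero := ⟨hU.zero, hV.zero⟩
  biprod X Y hX hY := ⟨hU.biprod X Y hX.1 hY.1, hV.biprod X Y hX.2 hY.2⟩
  iso e hX := ⟨hU.iso e hX.1, hV.iso e hX.2⟩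
  summand X Y h := ⟨hU.summand X Y h.1, hV.summand X Y h.2⟩

theorem isAdditiveSummandClosed_top : IsAdditiveSummandClosed (⊤ : ObjectProperty C) where
  zero := trivial
  biprod _ _ _ _ := trivial
  iso _ _ := trivial
  summand _ _ _ := trivial

theorem IsAdditiveSummandClosed.congruence {U : ObjectProperty C}
    (hU : IsAdditiveSummandClosed U) : Congruence (factorRel U) where
  equivalence :=
    { refl f := ⟨0, 0, 0, hU.zero, by simp⟩
      symm := by
        rintro f g ⟨W, a, b, hW, h⟩
        exact ⟨W, -a, b, hW, by simp [h]⟩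
      trans := by
        rintro f g k ⟨W, a, b, hW, h⟩ ⟨W', a', b', hW', h'⟩
        exact ⟨W ⊞ W', biprod.lift a a', biprod.desc b b', hU.biprod _ _ hW hW', by simp [h, h']⟩ }
  comp_left f := by
    rintro g g' ⟨W, a, b, hW, h⟩
    exact ⟨W, f ≫ a, b, hW, by simp [h]⟩
  comp_right f := by
    rintro ⟨W, a, b, hW, h⟩
    exact ⟨W, a, b ≫ f, hW, by simp [reassoc_of% h]⟩

/-- Closure of `U` under biproducts makes `factorRel U` a congruence, so equality in the quotient is
the relation itself. -/
theorem isoInQuotient_iff {U : ObjectProperty C} (hU : IsAdditiveSummandClosed U) {X Y : C}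
    (f : X ⟶ Y) : isoInQuotient U f ↔
      ∃ g : Y ⟶ X, factorRel U (f ≫ g) (𝟙 X) ∧ factorRel U (g ≫ f) (𝟙 Y) := by
  have := hU.congruence
  constructor
  · intro h
    have : IsIso ((Quotient.functor (factorRel U)).map f) := h
    obtain ⟨g, hg⟩ := (Quotient.functor (factorRel U)).map_surjective
      (inv ((Quotient.functor (factorRel U)).map f))
    exact ⟨g, (Quotient.functor_map_eq_iff _ _ _).1 (by simp [hg]),
      (Quotient.functor_map_eq_iff _ _ _).1 (by simp [hg])⟩
  · rintro ⟨g, h₁, h₂⟩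
    exact ⟨(Quotient.functor (factorRel U)).map g,
      ((Quotient.functor _).map_comp f g).symm.trans
        (((Quotient.functor_map_eq_iff _ _ _).2 h₁).trans ((Quotient.functor _).map_id _)),
      ((Quotient.functor _).map_comp g f).symm.trans
        (((Quotient.functor_map_eq_iff _ _ _).2 h₂).trans ((Quotient.functor _).map_id _))⟩

end Additive

/-! ### Projective and injective objects -/

namespace ExactStructure

variable {C : Type u} [Category.{v} C] [Preadditive C] (E : ExactStructure C)

theorem proj_of_retract {X Y : C} (i : X ⟶ Y) (r : Y ⟶ X) (h : i ≫ r = 𝟙 X) (hY : E.proj Y) :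
    E.proj X := by
  intro A B f hf x
  obtain ⟨y, hy⟩ := hY f hf (r ≫ x)
  exact ⟨i ≫ y, by simpa [reassoc_of% h] using i ≫= hy⟩

theorem inj_of_retract {X Y : C} (i : X ⟶ Y) (r : Y ⟶ X) (h : i ≫ r = 𝟙 X) (hY : E.inj Y) :
    E.inj X := by
  intro A B f hf x
  obtain ⟨y, hy⟩ := hY f hf (x ≫ i)
  exact ⟨y ≫ r, by simpa [h] using hy =≫ r⟩

theorem proj_iso {X Y : C} (e : X ≅ Y) (hX : E.proj X) : E.proj Y :=
  E.proj_of_retract e.inv e.hom e.inv_hom_id hX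

theorem inj_iso {X Y : C} (e : X ≅ Y) (hX : E.inj X) : E.inj Y :=
  E.inj_of_retract e.inv e.hom e.inv_hom_id hX

theorem inflationCoker_eq_inflation {U : ObjectProperty C} (hU : ∀ X, U X) :
    E.inflationCoker U = E.inflation := by
  ext A B f
  exact ⟨fun ⟨Z, g, w, h, _⟩ => ⟨Z, g, w, h⟩, fun ⟨Z, g, w, h⟩ => ⟨Z, g, w, h, hU Z⟩⟩

theorem deflationKer_eq_deflation {U : ObjectProperty C} (hU : ∀ X, U X) :
    E.deflationKer U = E.deflation := by
  ext A B f
  exact ⟨fun ⟨Z, g, w, h, _⟩ => ⟨Z, g, w, h⟩, fun ⟨Z, g, w, h⟩ => ⟨Z, g, w, h, hU Z⟩⟩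

variable [HasZeroObject C]

/-- A conflation with injective kernel splits: the identity of the kernel extends along the
inflation. -/
theorem splitEpiKer_inj : splitEpiKer E.inj = E.deflationKer E.inj := by
  ext A B f
  constructor
  · intro h
    obtain ⟨K, k, w, ⟨s⟩, hK⟩ := h.exists_splitting
    exact ⟨K, k, w, E.conflation_of_splitting s, hK⟩
  · rintro ⟨K, k, w, h, hK⟩
    obtain ⟨r, hr⟩ := hK k (E.inflation_of_conflation h) (𝟙 K)
    obtain ⟨hc⟩ := E.isCokernel _ h
    exact splitEpiKer_of_splitting (splittingOfRetraction w hc r hr) hK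

theorem inflationCoker_from_zero_iff {U : ObjectProperty C}
    (hU : ∀ {X Y : C}, (X ≅ Y) → U X → U Y) (X : C) :
    E.inflationCoker U (0 : (0 : C) ⟶ X) ↔ U X := by
  refine ⟨fun h => ?_, fun h =>
    ⟨X, 𝟙 X, zero_comp, E.conflation_of_splitting (splittingZeroLeft X), h⟩⟩
  obtain ⟨Z, g, w, hg, hZ⟩ := h
  obtain ⟨hc⟩ := E.isCokernel _ hg
  exact hU (hc.coconePointUniqueUpToIso (splittingZeroLeft X).gIsCokernel) hZ

variable [HasBinaryBiproducts C]

theorem isAdditiveSummandClosed_inj : IsAdditiveSummandClosed E.inj where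
  zero _ _ _ _ _ := ⟨0, Subsingleton.elim _ _⟩
  biprod X Y hX hY A B f hf x := by
    obtain ⟨a, ha⟩ := hX f hf (x ≫ biprod.fst)
    obtain ⟨b, hb⟩ := hY f hf (x ≫ biprod.snd)
    dsimp only at ha hb
    exact ⟨biprod.lift a b, by ext <;> simp [ha, hb]⟩
  iso := E.inj_iso
  summand X Y := E.inj_of_retract biprod.inl biprod.fst (by simp)

theorem isAdditiveSummandClosed_proj : IsAdditiveSummandClosed E.proj where
  zero _ _ _ _ _ := ⟨0, Subsingleton.elim _ _⟩
  biprod X Y hX hY A B f hf x := by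
    obtain ⟨a, ha⟩ := hX f hf (biprod.inl ≫ x)
    obtain ⟨b, hb⟩ := hY f hf (biprod.inr ≫ x)
    dsimp only at ha hb
    exact ⟨biprod.desc a b, by ext <;> simp [ha, hb]⟩
  iso := E.proj_iso
  summand X Y := E.proj_of_retract biprod.inl biprod.fst (by simp)

/-- A projective cover of the target factors through `f`, and cancellation applies. -/
theorem homFromEpic_proj (hC : WeaklyIdempotentComplete C) (h : E.EnoughProj) :
    homFromEpic E.proj = E.deflation := by
  ext A B f
  refine ⟨fun hf => ?_, fun hf P hP => hP f hf⟩
  obtain ⟨P, p, hP, hp⟩ := h B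
  obtain ⟨q, rfl⟩ := hf P hP p
  exact E.deflation_of_precomp hC q f hp

theorem homToEpic_inj (hC : WeaklyIdempotentComplete C) (h : E.EnoughInj) :
    homToEpic E.inj = E.inflation := by
  ext A B f
  refine ⟨fun hf => ?_, fun hf P hP => hP f hf⟩
  obtain ⟨P, p, hP, hp⟩ := h A
  obtain ⟨q, rfl⟩ := hf P hP p
  exact E.inflation_of_postcomp hC f q hp

end ExactStructure

/-! ### Maps inverted modulo a subcategory; first properties of `𝒲`-model structures -/

variable {C : Type u} [Category.{v} C] [Preadditive C] [HasZeroObject C]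

theorem splitMonoCoker_isoInQuotient [HasBinaryBiproducts C] {U : ObjectProperty C}
    (hU : IsAdditiveSummandClosed U) {A B : C} {f : A ⟶ B} (hf : splitMonoCoker U f) :
    isoInQuotient U f := by
  obtain ⟨Z, g, w, ⟨s⟩, hZ⟩ := hf.exists_splitting
  have h₁ : f ≫ s.r = 𝟙 A := s.f_r
  have h₂ : s.r ≫ f = 𝟙 B - g ≫ s.s := s.r_f
  exact (isoInQuotient_iff hU f).2 ⟨s.r, ⟨0, 0, 0, hU.zero, by simp [h₁]⟩,
    ⟨Z, -g, s.s, hZ, by simp [h₂]⟩⟩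

theorem splitEpiKer_isoInQuotient [HasBinaryBiproducts C] {U : ObjectProperty C}
    (hU : IsAdditiveSummandClosed U) {A B : C} {f : A ⟶ B} (hf : splitEpiKer U f) :
    isoInQuotient U f := by
  obtain ⟨K, k, w, ⟨s⟩, hK⟩ := hf.exists_splitting
  have h₁ : s.s ≫ f = 𝟙 B := s.s_g
  have h₂ : f ≫ s.s = 𝟙 A - s.r ≫ k := s.g_s
  exact (isoInQuotient_iff hU f).2 ⟨s.s, ⟨K, -s.r, k, hK, by simp [h₂]⟩,
    ⟨0, 0, 0, hU.zero, by simp [h₁]⟩⟩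

theorem IsWModelOf.cofibrant {M : ModelStructure C} {𝒲 : ObjectProperty C}
    (h : IsWModelOf M 𝒲) (X : C) : M.cofibrant X := by
  rw [ModelStructure.cofibrant, h.cof_eq]
  exact homToEpic_from_zero _ _

theorem IsWModelOf.fibrant {M : ModelStructure C} {𝒲 : ObjectProperty C}
    (h : IsWModelOf M 𝒲) (X : C) : M.fibrant X := by
  rw [ModelStructure.fibrant, h.fib_eq]
  exact homFromEpic_to_zero _ _

theorem IsWModelOf.contravariantlyFinite {M : ModelStructure C}
    {𝒲 : ObjectProperty C} (hW : IsWModelOf M 𝒲) : ContravariantlyFinite 𝒲 := by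
  intro B
  obtain ⟨W, i, p, hi, hp, -⟩ := M.fac_trivCof_fib (0 : (0 : C) ⟶ B)
  change M.trivCof i at hi
  rw [hW.trivCof_eq, show i = 0 from Subsingleton.elim _ _,
    splitMonoCoker_from_zero_iff hW.iso] at hi
  rw [hW.fib_eq] at hp
  exact ⟨W, p, hi, fun W' s hW' => hp W' hW' s⟩

namespace ExactStructure

variable {E : ExactStructure C} {M : ModelStructure C}

theorem IsExactModel.fib_eq_deflation (h : E.IsExactModel M) (hM : ∀ X, M.fibrant X) :
    M.fib = E.deflation :=
  h.fib_eq.trans (E.deflationKer_eq_deflation hM)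

theorem IsExactModel.cof_eq_inflation (h : E.IsExactModel M) (hM : ∀ X, M.cofibrant X) :
    M.cof = E.inflation :=
  h.cof_eq.trans (E.inflationCoker_eq_inflation hM)

/-! ### Exact `ω`-model structures -/

section Omega

variable [HasBinaryBiproducts C] {𝒳 𝒴 : ObjectProperty C}

theorem IsOmegaModelOf.fibrant (h : E.IsOmegaModelOf M 𝒳 𝒴) (X : C) : M.fibrant X := by
  rw [ModelStructure.fibrant, h.fib_eq]
  exact homFromEpic_to_zero _ _

theorem IsOmegaModelOf.cofibrant_eq (h : E.IsOmegaModelOf M 𝒳 𝒴) : M.cofibrant = 𝒳 := by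
  ext X
  rw [ModelStructure.cofibrant, h.cof_eq, E.inflationCoker_from_zero_iff h.left.iso]

theorem IsOmegaModelOf.isExactModel_iff_isProjectiveModel (h : E.IsOmegaModelOf M 𝒳 𝒴) :
    E.IsExactModel M ↔ E.IsProjectiveModel M :=
  ⟨fun hE => ⟨hE, h.fibrant⟩, fun hE => hE.exact⟩

theorem IsOmegaModelOf.enoughProj (hC : WeaklyIdempotentComplete C)
    (h : E.IsOmegaModelOf M 𝒳 𝒴) (hE : E.IsExactModel M) :
    E.EnoughProj ∧ 𝒳 ⊓ 𝒴 = E.proj := by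
  have hω := h.left.inf h.right
  have hfib := hE.fib_eq_deflation h.fibrant
  have hωproj : ∀ W, (𝒳 ⊓ 𝒴) W → E.proj W := by
    intro W hW A B f hf
    rw [← hfib, h.fib_eq] at hf
    exact hf W hW
  -- In a factorization `0 ⟶ W ⟶ B`, the trivial cofibration puts `W` in `ω` and the fibration is a
  -- deflation.
  have hcover : ∀ B : C, ∃ (W : C) (p : W ⟶ B), (𝒳 ⊓ 𝒴) W ∧ E.deflation p := by
    intro B
    obtain ⟨W, i, p, hi, hp, -⟩ := M.fac_trivCof_fib (0 : (0 : C) ⟶ B)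
    change M.trivCof i at hi
    rw [h.trivCof_eq, show i = 0 from Subsingleton.elim _ _,
      splitMonoCoker_from_zero_iff hω.iso] at hi
    rw [hfib] at hp
    exact ⟨W, p, hi, hp⟩
  refine ⟨fun X => ?_, ?_⟩
  · obtain ⟨W, p, hW, hp⟩ := hcover X
    exact ⟨W, p, hωproj W hW, hp⟩
  · ext P
    refine ⟨hωproj P, fun hP => ?_⟩
    obtain ⟨W, p, hW, hp⟩ := hcover P
    obtain ⟨s, hs⟩ := hP p hp (𝟙 P)
    exact hω.of_retract hC s p hs hW

theorem IsOmegaModelOf.isExactModel (hC : WeaklyIdempotentComplete C)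
    (h : E.IsOmegaModelOf M 𝒳 𝒴) (hP : E.EnoughProj) (hω : 𝒳 ⊓ 𝒴 = E.proj) :
    E.IsExactModel M where
  cof_eq := by rw [h.cofibrant_eq, h.cof_eq]
  fib_eq := by
    rw [E.deflationKer_eq_deflation h.fibrant, h.fib_eq, hω, E.homFromEpic_proj hC hP]

end Omega

/-! ### `𝒲`-model structures that are `ω`-model structures -/

section WModel

variable [HasBinaryBiproducts C] {𝒲 𝒳 𝒴 : ObjectProperty C}

theorem IsOmegaModelOf.inf_eq_of_isWModelOf (h : E.IsOmegaModelOf M 𝒳 𝒴)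
    (hW : IsWModelOf M 𝒲) : 𝒳 ⊓ 𝒴 = 𝒲 :=
  splitMonoCoker_injective (h.left.inf h.right).iso hW.iso (h.trivCof_eq.symm.trans hW.trivCof_eq)

theorem IsOmegaModelOf.enoughInj_of_isWModelOf (hC : WeaklyIdempotentComplete C)
    (h : E.IsOmegaModelOf M 𝒳 𝒴) (hW : IsWModelOf M 𝒲) : E.EnoughInj ∧ 𝒲 = E.inj := by
  have hω := h.inf_eq_of_isWModelOf hW
  have hadd := h.left.inf h.right
  rw [hω] at hadd
  have hcof : M.cof = E.inflation := by
    rw [h.cof_eq, ← h.cofibrant_eq]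
    exact E.inflationCoker_eq_inflation hW.cofibrant
  have hinj : ∀ I, 𝒲 I → E.inj I := by
    intro I hI A B f hf
    rw [← hcof, hW.cof_eq] at hf
    exact hf I hI
  have hembed : ∀ X : C, ∃ (I : C) (i : X ⟶ I), 𝒲 I ∧ E.inflation i := by
    intro X
    obtain ⟨I, i, p, hi, hp, -⟩ := M.fac_cof_trivFib (0 : X ⟶ (0 : C))
    change M.trivFib p at hp
    rw [hW.trivFib_eq, show p = 0 from Subsingleton.elim _ _,
      splitEpiKer_to_zero_iff hW.iso] at hp
    rw [hcof] at hi
    exact ⟨I, i, hp, hi⟩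
  refine ⟨fun X => ?_, ?_⟩
  · obtain ⟨I, i, hI, hi⟩ := hembed X
    exact ⟨I, i, hinj I hI, hi⟩
  · ext X
    refine ⟨hinj X, fun hX => ?_⟩
    obtain ⟨I, i, hI, hi⟩ := hembed X
    obtain ⟨r, hr⟩ := hX i hi (𝟙 X)
    exact hadd.of_retract hC i r hr hI

theorem isOmegaModelOf_of_isWModelOf_inj (hC : WeaklyIdempotentComplete C) (hI : E.EnoughInj)
    (hW : IsWModelOf M E.inj) : E.IsOmegaModelOf M ⊤ E.inj where
  left := isAdditiveSummandClosed_top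
  right := E.isAdditiveSummandClosed_inj
  cof_eq := by
    rw [hW.cof_eq, E.homToEpic_inj hC hI, E.inflationCoker_eq_inflation (U := ⊤) fun _ => trivial]
  fib_eq := by rw [hW.fib_eq, top_inf_eq]
  trivCof_eq := by rw [hW.trivCof_eq, top_inf_eq]
  trivFib_eq := by rw [hW.trivFib_eq, E.splitEpiKer_inj]
  weq_eq := by rw [hW.weq_eq, top_inf_eq, E.splitEpiKer_inj]

end WModel

/-! ### Frobenius model structures -/

section Frobenius

theorem IsFrobeniusModel.cof_eq (h : E.IsFrobeniusModel M) : M.cof = E.inflation :=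
  h.injective.exact.cof_eq_inflation h.injective.cofibrant

theorem IsFrobeniusModel.fib_eq (h : E.IsFrobeniusModel M) : M.fib = E.deflation :=
  h.projective.exact.fib_eq_deflation h.projective.fibrant

theorem IsFrobeniusModel.trivCof_eq (h : E.IsFrobeniusModel M) :
    M.trivCof = splitMonoCoker E.proj := by
  ext A B i
  constructor
  · rintro ⟨hi, hi'⟩
    have hlift : ∀ {X Y : C} (p : X ⟶ Y), M.fib p → HasLiftingProperty i p :=
      fun p hp => M.lift_trivCof i p hi hi' hp
    -- Lifting against the fibration `A ⟶ 0` gives a retraction of `i`.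
    have := hlift _ (h.projective.fibrant A)
    have sq : CommSq (𝟙 A) i (0 : A ⟶ (0 : C)) 0 := ⟨Subsingleton.elim _ _⟩
    rw [h.cof_eq] at hi
    obtain ⟨Z, g, w, hg⟩ := hi
    obtain ⟨hc⟩ := E.isCokernel _ hg
    refine splitMonoCoker_of_splitting (splittingOfRetraction w hc sq.lift sq.fac_left) ?_
    intro X Y p hp z
    have := hlift p (by rwa [h.fib_eq])
    -- A lift in this square vanishes on `A`, so it descends to `Z` and lifts `z` through `p`.
    have sq : CommSq (0 : A ⟶ X) i p (g ≫ z) := ⟨by simp [reassoc_of% w]⟩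
    obtain ⟨l, hl⟩ := CokernelCofork.IsColimit.desc' hc sq.lift sq.fac_left
    change g ≫ l = sq.lift at hl
    refine ⟨l, Cofork.IsColimit.hom_ext hc ?_⟩
    change g ≫ l ≫ p = g ≫ z
    rw [reassoc_of% hl, sq.fac_right]
  · intro hi
    obtain ⟨Z, g, w, ⟨s⟩, hZ⟩ := hi.exists_splitting
    refine M.trivCof_of_llp i fun {X Y} p hp => ⟨fun {u v} sq => ?_⟩
    rw [h.fib_eq] at hp
    obtain ⟨t, ht⟩ := hZ p hp (s.s ≫ v)
    have h₁ : i ≫ s.r = 𝟙 A := s.f_r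
    have h₂ : s.r ≫ i = 𝟙 B - g ≫ s.s := s.r_f
    dsimp only at ht
    -- The lift is given on each summand of `B ≅ A ⊞ Z`: by `u` on `A`, and on `Z` by projectivity.
    exact ⟨⟨⟨s.r ≫ u + g ≫ t, by simp [reassoc_of% h₁, reassoc_of% w],
      by simp [sq.w, ht, reassoc_of% h₂]⟩⟩⟩

theorem IsFrobeniusModel.trivFib_eq (h : E.IsFrobeniusModel M) :
    M.trivFib = splitEpiKer E.inj := by
  ext A B p
  constructor
  · rintro ⟨hp, hp'⟩
    have hlift : ∀ {X Y : C} (i : X ⟶ Y), M.cof i → HasLiftingProperty i p :=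
      fun i hi => M.lift_trivFib i p hi hp hp'
    have := hlift _ (h.injective.cofibrant B)
    have sq : CommSq 0 (0 : (0 : C) ⟶ B) p (𝟙 B) := ⟨Subsingleton.elim _ _⟩
    rw [h.fib_eq] at hp
    obtain ⟨K, k, w, hk⟩ := hp
    obtain ⟨hc⟩ := E.isKernel _ hk
    refine splitEpiKer_of_splitting (splittingOfSection w hc sq.lift sq.fac_right) ?_
    intro X Y j hj x
    have := hlift j (by rwa [h.cof_eq])
    have sq : CommSq (x ≫ k) j p (0 : Y ⟶ B) := ⟨by simp [w]⟩
    obtain ⟨l, hl⟩ := KernelFork.IsLimit.lift' hc sq.lift sq.fac_right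
    change l ≫ k = sq.lift at hl
    refine ⟨l, Fork.IsLimit.hom_ext hc ?_⟩
    change (j ≫ l) ≫ k = x ≫ k
    rw [Category.assoc, hl, sq.fac_left]
  · intro hp
    obtain ⟨K, k, w, ⟨s⟩, hK⟩ := hp.exists_splitting
    refine M.trivFib_of_rlp p fun {X Y} j hj => ⟨fun {u v} sq => ?_⟩
    rw [h.cof_eq] at hj
    obtain ⟨t, ht⟩ := hK j hj (u ≫ s.r)
    have h₁ : s.s ≫ p = 𝟙 B := s.s_g
    have h₂ : s.r ≫ k = 𝟙 A - p ≫ s.s := s.r_f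
    dsimp only at ht
    have hw := sq.w
    exact ⟨⟨⟨v ≫ s.s + t ≫ k, by simp [← reassoc_of% hw, reassoc_of% ht, h₂], by simp [h₁, w]⟩⟩⟩

theorem IsFrobeniusModel.proj_eq_inj (h : E.IsFrobeniusModel M) : E.proj = E.inj := by
  ext X
  rw [← splitMonoCoker_from_zero_iff E.proj_iso, ← splitEpiKer_to_zero_iff E.inj_iso,
    ← h.trivCof_eq, ← h.trivFib_eq]
  have hX := M.weq_from_zero_iff X
  exact ⟨fun h₁ => ⟨h.projective.fibrant X, hX.1 h₁.2⟩,
    fun h₁ => ⟨h.injective.cofibrant X, hX.2 h₁.2⟩⟩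

theorem IsFrobeniusModel.enoughProj (h : E.IsFrobeniusModel M) : E.EnoughProj := by
  intro X
  obtain ⟨P, i, p, hi, hp, -⟩ := M.fac_trivCof_fib (0 : (0 : C) ⟶ X)
  change M.trivCof i at hi
  rw [h.trivCof_eq, show i = 0 from Subsingleton.elim _ _,
    splitMonoCoker_from_zero_iff E.proj_iso] at hi
  rw [h.fib_eq] at hp
  exact ⟨P, p, hi, hp⟩

theorem IsFrobeniusModel.enoughInj (h : E.IsFrobeniusModel M) : E.EnoughInj := by
  intro X
  obtain ⟨I, i, p, hi, hp, -⟩ := M.fac_cof_trivFib (0 : X ⟶ (0 : C))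
  change M.trivFib p at hp
  rw [h.trivFib_eq, show p = 0 from Subsingleton.elim _ _,
    splitEpiKer_to_zero_iff E.inj_iso] at hp
  rw [h.cof_eq] at hi
  exact ⟨I, i, hp, hi⟩

theorem isFrobeniusModel_of_isWModelOf {𝒲 : ObjectProperty C} (hE : E.IsExactModel M)
    (hW : IsWModelOf M 𝒲) : E.IsFrobeniusModel M :=
  ⟨⟨hE, hW.fibrant⟩, ⟨hE, hW.cofibrant⟩⟩

variable [HasBinaryBiproducts C]

theorem IsFrobeniusModel.isWModelOf (hC : WeaklyIdempotentComplete C)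
    (h : E.IsFrobeniusModel M) : IsWModelOf M E.inj where
  iso := E.inj_iso
  cof_eq := by rw [h.cof_eq, E.homToEpic_inj hC h.enoughInj]
  fib_eq := by rw [h.fib_eq, ← h.proj_eq_inj, E.homFromEpic_proj hC h.enoughProj]
  trivCof_eq := by rw [h.trivCof_eq, h.proj_eq_inj]
  trivFib_eq := h.trivFib_eq
  weq_eq := by rw [M.weq_eq_compClass, h.trivCof_eq, h.trivFib_eq, h.proj_eq_inj]

/-- A deflation that becomes invertible modulo projectives is a split epimorphism with projective
kernel. -/
theorem splitEpiKer_of_isoInQuotient (hC : WeaklyIdempotentComplete C) {A B : C} {p : A ⟶ B}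
    (hp : E.deflation p) (hq : isoInQuotient E.proj p) : splitEpiKer E.proj p := by
  obtain ⟨s, ⟨W, a, b, hW, hab⟩, ⟨V, c, d, hV, hcd⟩⟩ :=
    (isoInQuotient_iff E.isAdditiveSummandClosed_proj p).1 hq
  -- The error `s ≫ p - 𝟙 B = c ≫ d` passes through a projective, so `d` lifts along `p`;
  -- subtracting `c ≫ d'` turns `s` into a genuine section.
  obtain ⟨d', hd⟩ := hV p hp d
  dsimp only at hd
  obtain ⟨K, k, w, ⟨t⟩⟩ := exists_splitting_of_section hC p (s - c ≫ d') (by simp [hd, hcd])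
  -- On the kernel, `a ≫ b = p ≫ s - 𝟙 A` restricts to `-k`, so `K` is a retract of the projective
  -- `W`.
  refine splitEpiKer_of_splitting t (E.proj_of_retract (-(k ≫ a)) (b ≫ t.r) ?_ hW)
  have h₁ : k ≫ t.r = 𝟙 K := t.f_r
  calc (-(k ≫ a)) ≫ b ≫ t.r = -(k ≫ (a ≫ b) ≫ t.r) := by simp
    _ = 𝟙 K := by simp [hab, reassoc_of% w, h₁]

theorem IsFrobeniusModel.weq_eq (hC : WeaklyIdempotentComplete C) (h : E.IsFrobeniusModel M) :
    M.weq = isoInQuotient E.proj := by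
  have := M.two_out_of_three
  have hadd := E.isAdditiveSummandClosed_proj
  have : (isoInQuotient E.proj).HasTwoOutOfThreeProperty := by
    unfold isoInQuotient; infer_instance
  ext A B f
  constructor
  · rw [M.weq_eq_compClass, h.trivCof_eq, h.trivFib_eq, ← h.proj_eq_inj]
    rintro ⟨Z, i, p, hi, hp, rfl⟩
    exact (isoInQuotient E.proj).comp_mem _ _ (splitMonoCoker_isoInQuotient hadd hi)
      (splitEpiKer_isoInQuotient hadd hp)
  · intro hf
    obtain ⟨Z, i, p, hi, hp, rfl⟩ := M.fac_trivCof_fib f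
    refine M.weq.comp_mem _ _ hi.2 ?_
    change M.trivCof i at hi
    rw [h.trivCof_eq] at hi
    rw [h.fib_eq] at hp
    have hp' := splitEpiKer_of_isoInQuotient hC hp
      ((isoInQuotient E.proj).of_precomp _ _ (splitMonoCoker_isoInQuotient hadd hi) hf)
    rw [h.proj_eq_inj, ← h.trivFib_eq] at hp'
    exact hp'.2

end Frobenius

end ExactStructure

end ExactModel

/-! ### The three parts of the proposition -/

theorem proposition5 {C : Type u} [Category.{v} C] [Preadditive C] [HasZeroObject C]
    [HasBinaryBiproducts C] (hC : ExactModel.WeaklyIdempotentComplete C)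
    (E : ExactModel.ExactStructure C) :
    -- Part (1)
    (∀ (M : ExactModel.ModelStructure C) (𝒳 𝒴 : ObjectProperty C), E.IsOmegaModelOf M 𝒳 𝒴 →
      (E.IsExactModel M ↔ (E.EnoughProj ∧ 𝒳 ⊓ 𝒴 = E.proj)) ∧
      (E.IsExactModel M ↔ E.IsProjectiveModel M) ∧
      (E.IsExactModel M →
        M.cof = E.inflationCoker 𝒳 ∧
        M.fib = E.deflation ∧
        M.trivCof = ExactModel.splitMonoCoker E.proj ∧
        M.trivFib = E.deflationKer 𝒴 ∧
        M.weq = ExactModel.compClass M.trivCof M.trivFib)) ∧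
    -- Part (2)
    (∀ (M : ExactModel.ModelStructure C) (𝒲 : ObjectProperty C), ExactModel.IsWModelOf M 𝒲 →
      (E.IsOmegaModel M ↔ (E.EnoughInj ∧ 𝒲 = E.inj)) ∧
      (E.IsOmegaModel M →
        𝒲 = E.inj ∧
        (∀ 𝒳 𝒴 : ObjectProperty C, E.IsOmegaModelOf M 𝒳 𝒴 →
          𝒳 ⊓ 𝒴 = 𝒲 ∧
          M.weq = ExactModel.compClass (ExactModel.splitMonoCoker (𝒳 ⊓ 𝒴)) (E.deflationKer 𝒴)) ∧
        ExactModel.ContravariantlyFinite E.inj ∧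
        M.cof = E.inflation ∧
        M.fib = ExactModel.homFromEpic E.inj ∧
        M.trivCof = ExactModel.splitMonoCoker E.inj ∧
        M.trivFib = ExactModel.splitEpiKer E.inj ∧
        M.weq = ExactModel.compClass M.trivCof M.trivFib)) ∧
    -- Part (3)
    (∀ M : ExactModel.ModelStructure C,
      ((E.IsExactModel M ∧ ExactModel.IsWModel M) ↔ E.IsFrobeniusModel M) ∧
      (E.IsFrobeniusModel M ↔
        (E.IsExactModel M ∧ E.IsOmegaModel M ∧ ExactModel.IsWModel M)) ∧
      (E.IsFrobeniusModel M →
        (∀ 𝒳 𝒴 : ObjectProperty C, E.IsOmegaModelOf M 𝒳 𝒴 → 𝒳 ⊓ 𝒴 = E.proj) ∧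
        (∀ 𝒲 : ObjectProperty C, ExactModel.IsWModelOf M 𝒲 → 𝒲 = E.proj) ∧
        E.proj = E.inj ∧
        M.cof = E.inflation ∧
        M.fib = E.deflation ∧
        M.weq = ExactModel.isoInQuotient E.proj)) := by
  refine ⟨fun M 𝒳 𝒴 h => ⟨⟨fun hE => h.enoughProj hC hE, fun hP => h.isExactModel hC hP.1 hP.2⟩,
    h.isExactModel_iff_isProjectiveModel, fun hE => ?_⟩,
    fun M 𝒲 hW => ⟨⟨?_, ?_⟩, ?_⟩, fun M => ⟨⟨?_, fun h => ?_⟩, ⟨fun h => ?_, ?_⟩, fun h => ?_⟩⟩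
  · have hω := (h.enoughProj hC hE).2
    exact ⟨h.cof_eq, hE.fib_eq_deflation h.fibrant, h.trivCof_eq.trans (by rw [hω]),
      h.trivFib_eq, M.weq_eq_compClass⟩
  · rintro ⟨𝒳, 𝒴, h⟩
    exact h.enoughInj_of_isWModelOf hC hW
  · rintro ⟨hI, rfl⟩
    exact ⟨_, _, ExactModel.ExactStructure.isOmegaModelOf_of_isWModelOf_inj hC hI hW⟩
  · rintro ⟨𝒳, 𝒴, h⟩
    obtain ⟨hI, rfl⟩ := h.enoughInj_of_isWModelOf hC hW
    exact ⟨rfl, fun 𝒳' 𝒴' h' => ⟨h'.inf_eq_of_isWModelOf hW, h'.weq_eq⟩,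
      hW.contravariantlyFinite, hW.cof_eq.trans (E.homToEpic_inj hC hI), hW.fib_eq,
      hW.trivCof_eq, hW.trivFib_eq, M.weq_eq_compClass⟩
  · rintro ⟨hE, 𝒲, hW⟩
    exact ExactModel.ExactStructure.isFrobeniusModel_of_isWModelOf hE hW
  · exact ⟨h.projective.exact, _, h.isWModelOf hC⟩
  · have hW := h.isWModelOf hC
    exact ⟨h.projective.exact,
      ⟨_, _, ExactModel.ExactStructure.isOmegaModelOf_of_isWModelOf_inj hC h.enoughInj hW⟩, _, hW⟩
  · rintro ⟨hE, -, 𝒲, hW⟩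
    exact ExactModel.ExactStructure.isFrobeniusModel_of_isWModelOf hE hW
  · exact ⟨fun 𝒳 𝒴 hω => (hω.enoughProj hC h.projective.exact).2,
      fun 𝒲 hW => ExactModel.splitMonoCoker_injective hW.iso E.proj_iso
        (hW.trivCof_eq.symm.trans h.trivCof_eq),
      h.proj_eq_inj, h.cof_eq, h.fib_eq, h.weq_eq hC⟩
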